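/- For $m\ge 0$ let $[m]=\{1,\dots,m\}$ (so $[0]=\emptyset$), and let $\binom{X}{k}$ be the family of all $k$-element subsets of a set $X$. Two families $\mathcal F,\mathcal G$ are cross-intersecting if $F\cap G\neq\emptyset$ for all $F\in\mathcal F$, $G\in\mathcal G$. The covering number $\tau(\mathcal F)$ of a family $\mathcal F$ of non-empty subsets of $[n]$ is the least size of a set $T\subseteq[n]$ that meets every member of $\mathcal F$. For $1\le i<j\le n$ the shift $S_{ij}(\mathcal F)$ is obtained from $\mathcal F$ by replacing each $F\in\mathcal F$ with $j\in F$, $i\notin F$ and $(F\setminus\{j\})\cup\{i\}\notin\mathcal F$ by $(F\setminus\{j\})\cup\{i\}$; the family $\mathcal F$ is initial if $S_{ij}(\mathcal F)=\mathcal F$ for all $1\le i<j\le n$. Two families of subsets of $[n]$ are isomorphic if a permutation of $[n]$ maps one onto the other. Put $$\mathcal H_s^t(n,a,b)=\Bigl\{A\in\tbinom{[n]}{a}: A\cap[s]\ne\emptyset,\ |A\cap[b+t-1]|\ge t\Bigr\}\cup\Bigl\{B\in\tbinom{[n]}{b}:[s]\subseteq B\Bigr\}\cup\tbinom{[b+t-1]}{b}.$$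 **Theorem.** Let $\mathcal F\subseteq\binom{[n]}{a}$ and $\mathcal G\subseteq\binom{[n]}{b}$ be initial cross-intersecting families with $a\ge b+t-1$, $\tau(\mathcal F)=s$ and $\tau(\mathcal G)\ge t\ge 2$, and let $n\ge a+b$. Then $$|\mathcal F|+|\mathcal G|\le|\mathcal H_s^t(n,a,b)|,$$ and $$|\mathcal H_s^t(n,a,b)|=\sum_{j=1}^{s}\left(\binom{n-j}{a-1}-\sum_{i=0}^{t-2}\binom{b+t-j-1}{i}\binom{n-b-t+1}{a-i-1}\right)+\binom{n-s}{b-s}+\binom{b+t-1}{b}-\binom{b+t-s-1}{b-s}.$$ Moreover, let $n>a+b$. If $\mathcal F\cup\mathcal G$ is isomorphic to $\mathcal H_s^t(n,a,b)$, then $|\mathcal F|+|\mathcal G|=|\mathcal H_s^t(n,a,b)|$. Conversely, unless $s=1$, $a=b+t-1$, $b\ge 2$ and ($b=2$ or $t=2$), the equality $|\mathcal F|+|\mathcal G|=|\mathcal H_s^t(n,a,b)|$ implies that $\mathcal F\cup\mathcal G$ is isomorphic to $\mathcal H_s^t(n,a,b)$. -/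

import Mathlib

/-! Families of finite sets on the ground set `[n] = {1, …, n}`. -/

namespace CrossFam

/-- The family of all `k`-element subsets of the set `X`. For `X = [n]` this is the family
of all `k`-subsets of `{1, …, n}`. -/
abbrev kSubsets (X : Finset ℕ) (k : ℕ) : Finset (Finset ℕ) :=
  Finset.powersetCard k X

/-- Every member of `F` meets every member of `G`. -/
def CrossIntersecting (F G : Finset (Finset ℕ)) : Prop :=
  ∀ A ∈ F, ∀ B ∈ G, (A ∩ B).Nonempty

/-- The shift of one set `A`, relative to the family `F`: replace `j` by `i` if `j ∈ A`, `i ∉ A`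
and the resulting set is not already in `F`; otherwise keep `A`. -/
def shiftSet (i j : ℕ) (F : Finset (Finset ℕ)) (A : Finset ℕ) : Finset ℕ :=
  if j ∈ A ∧ i ∉ A ∧ insert i (A.erase j) ∉ F then insert i (A.erase j) else A

/-- The shifting operation `S_{ij}` on families. -/
def shift (i j : ℕ) (F : Finset (Finset ℕ)) : Finset (Finset ℕ) :=
  F.image (shiftSet i j F)

/-- A family on `[n]` is initial (left-shifted) if `S_{ij}` fixes it for all `1 ≤ i < j ≤ n`. -/
def IsInitial (n : ℕ) (F : Finset (Finset ℕ)) : Prop :=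
  ∀ i j : ℕ, 1 ≤ i → i < j → j ≤ n → shift i j F = F

/-- `T ⊆ [n]` meets every member of `F`. -/
def IsCover (n : ℕ) (F : Finset (Finset ℕ)) (T : Finset ℕ) : Prop :=
  T ⊆ Finset.Icc 1 n ∧ ∀ A ∈ F, (T ∩ A).Nonempty

/-- The covering number: the least size of a cover `T ⊆ [n]` of `F`. For a family of nonempty
subsets of `[n]` the set of sizes is nonempty, as `[n]` itself is a cover. The covering number
of a family with the empty set as a member is not defined on paper; here it is `0`. -/
noncomputable def coveringNumber (n : ℕ) (F : Finset (Finset ℕ)) : ℕ :=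
  sInf {k : ℕ | ∃ T : Finset ℕ, IsCover n F T ∧ T.card = k}

/-- Two families of subsets of `[n]` are isomorphic: a permutation of `[n]` maps one onto
the other. -/
def Isomorphic (n : ℕ) (F G : Finset (Finset ℕ)) : Prop :=
  ∃ σ : ℕ → ℕ, Set.BijOn σ (Finset.Icc 1 n : Finset ℕ) (Finset.Icc 1 n : Finset ℕ) ∧
    F.image (fun A => A.image σ) = G

/-- The family `H_s^t(n,a,b)`: the `a`-subsets of `[n]` that meet `[s]` and have at least `t`
elements in `[b+t-1]`, the `b`-subsets of `[n]` that contain `[s]`, and all `b`-subsets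
of `[b+t-1]`. -/
def extremal (n a b s t : ℕ) : Finset (Finset ℕ) :=
  (kSubsets (Finset.Icc 1 n) a).filter
      (fun A => (A ∩ Finset.Icc 1 s).Nonempty ∧ t ≤ (A ∩ Finset.Icc 1 (b + t - 1)).card) ∪
    (kSubsets (Finset.Icc 1 n) b).filter (fun B => Finset.Icc 1 s ⊆ B) ∪
    kSubsets (Finset.Icc 1 (b + t - 1)) b

end CrossFam

namespace CrossFam

open Finset

/-! Put `m = b + t - 1` and split the extremal family into its `a`-sets `L` and its `b`-sets `R`.
Since `G` is initial and no `t - 1` points cover it, `G` contains every `b`-subset of `[m]`; since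
`F` is initial, `[s]` covers it. Both facts together with cross-intersection give `F ⊆ L`. What
remains is `|G \ R| ≤ |L \ F|`.

A member of `G \ R` has a first missing element `i ≤ s`, so it is `[i-1] ∪ C` with `C ⊆ U ∪ V`, `U =
(i, m]`, `V = (m, n]`. If an `(a-1)`-set `D ⊆ U ∪ V` is disjoint from `C` and contains `U \ C`, then
`{i} ∪ D` lies in `L` but misses a member of `G`, so it is not in `F`. Different `i` give different
sets, and it suffices that for each `i` there are at least as many such `D` as `C`
(`card_le_card_complNbrs`).

That inequality is proved by layers `j = |C ∩ U|`. Double counting of pairs `(C, D)` bounds each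
layer of the `D` from below (`layer_card_le`). Initiality makes the layer density increase with `j`
(`layer_density_mono`). The resulting weighted sum has weights antisymmetric under `j ↦ β - δ - j`,
where `|C| = β` and `|D| = |U| + δ`, so it is nonnegative (`sum_layers_nonneg`).

For `n > a + b`, equality with a nonempty class forces `δ ≤ 1` and closure under exchanges inside
`V`. Outside the exceptional parameters this yields disjoint members of `F` and `G`; hence every
class is empty, `F = L` and `G = R`. -/

/-! ### Binomial inequalities, double counting, exchanges and reflected sums. -/

theorem choose_le_choose_of_add_le {N k l : ℕ} (hkl : k ≤ l) (h : k + l ≤ N) :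
    N.choose k ≤ N.choose l := by
  induction hd : l - k using Nat.strong_induction_on generalizing k l with
  | _ d ih =>
    rcases Nat.eq_or_lt_of_le hkl with rfl | hlt
    · exact le_rfl
    rcases Nat.eq_or_lt_of_le h with h' | h'
    · rw [← Nat.choose_symm_of_eq_add (show N = l + k by omega)]
    · have h1 : N.choose k ≤ N.choose (k + 1) := by
        have := Nat.choose_succ_right_eq N k
        have h2 : k + 1 ≤ N - k := by omega
        have h3 : N.choose k * (k + 1) ≤ N.choose (k + 1) * (k + 1) := by
          rw [this]; exact Nat.mul_le_mul_left _ h2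
        exact Nat.le_of_mul_le_mul_right h3 (Nat.succ_pos k)
      exact h1.trans (ih (l - (k + 1)) (by omega) hlt (by omega) rfl)

theorem choose_lt_choose_of_add_lt {N k l : ℕ} (hkl : k < l) (h : k + l < N) :
    N.choose k < N.choose l := by
  have h1 : N.choose k < N.choose (k + 1) := by
    have := Nat.choose_succ_right_eq N k
    have h2 : k + 1 < N - k := by omega
    have hpos : 0 < N.choose k := Nat.choose_pos (by omega)
    have h3 : N.choose k * (k + 1) < N.choose (k + 1) * (k + 1) := by
      rw [this]; exact Nat.mul_lt_mul_of_pos_left h2 hpos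
    exact lt_of_mul_lt_mul_right h3 (Nat.zero_le _)
  exact h1.trans_le (choose_le_choose_of_add_le hkl (by omega))

theorem lt_choose_of_two_le {M j : ℕ} (h2 : 2 ≤ j) (h : j + 2 ≤ M) : M < M.choose j := by
  simpa using choose_lt_choose_of_add_lt (N := M) (k := 1) (l := j) (by omega) (by omega)

/-- Double counting of related pairs. In the equality case each `D` already has `y` neighbours in
`S`, which leaves none in `Ω \ S`; this is the source of all rigidity in the uniqueness part. -/
theorem card_mul_le_card_mul_of_degrees {α β : Type*} [DecidableEq α] (r : α → β → Prop)
    [∀ a b, Decidable (r a b)] {S Ω : Finset α} {T : Finset β} {x y : ℕ} (hS : S ⊆ Ω)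
    (hx : ∀ C ∈ S, x ≤ #{D ∈ T | r C D}) (hy : ∀ D ∈ T, #{C ∈ Ω | r C D} ≤ y) :
    #S * x ≤ #T * y ∧ (#S * x = #T * y → ∀ D ∈ T, ∀ C ∈ Ω, r C D → C ∈ S) := by
  have h1 : #S * x ≤ ∑ C ∈ S, #{D ∈ T | r C D} := by
    simpa using Finset.card_nsmul_le_sum S _ x hx
  have h2 : ∑ C ∈ S, #{D ∈ T | r C D} = ∑ D ∈ T, #{C ∈ S | r C D} :=
    Finset.sum_card_bipartiteAbove_eq_sum_card_bipartiteBelow r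
  have hsub : ∀ D, ({C ∈ S | r C D} : Finset α) ⊆ {C ∈ Ω | r C D} := fun D =>
    Finset.filter_subset_filter _ hS
  have h3 : ∀ D ∈ T, #{C ∈ S | r C D} ≤ y := fun D hD =>
    (Finset.card_le_card (hsub D)).trans (hy D hD)
  have h4 : ∑ D ∈ T, #{C ∈ S | r C D} ≤ ∑ _D ∈ T, y := Finset.sum_le_sum h3
  have h5 : ∑ _D ∈ T, y = #T * y := by simp
  refine ⟨by omega, fun h D hD C hC hr => ?_⟩
  have h6 := (Finset.sum_eq_sum_iff_of_le h3).1 (by omega) D hD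
  have h7 := Finset.eq_of_subset_of_card_le (hsub D) (by rw [h6]; exact hy D hD)
  have h8 : C ∈ ({C ∈ S | r C D} : Finset α) := by rw [h7]; simp [hC, hr]
  exact (Finset.mem_filter.1 h8).1

/-- A family closed under the exchanges that `R` allows contains every set that arises from a
member by exchanging elements all of whose pairs are allowed. -/
theorem mem_of_exchange {α : Type*} [DecidableEq α] {𝒢 : Finset (Finset α)} {R : α → α → Prop}
    (h : ∀ C ∈ 𝒢, ∀ x y, y ∈ C → x ∉ C → R x y → insert x (C.erase y) ∈ 𝒢)
    {A A' : Finset α} (hA : A ∈ 𝒢) (hc : #A' = #A)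
    (hR : ∀ x ∈ A' \ A, ∀ y ∈ A \ A', R x y) : A' ∈ 𝒢 := by
  induction hk : #(A' \ A) generalizing A with
  | zero =>
    have : A' ⊆ A := by
      rw [Finset.card_eq_zero, Finset.sdiff_eq_empty_iff_subset] at hk; exact hk
    rwa [Finset.eq_of_subset_of_card_le this hc.ge]
  | succ k ih =>
    have e := Finset.card_sdiff_add_card A' A
    have e' := Finset.card_sdiff_add_card A A'
    rw [Finset.union_comm] at e'
    obtain ⟨x, hx⟩ := Finset.card_pos.1 (show 0 < #(A' \ A) by omega)
    obtain ⟨y, hy⟩ := Finset.card_pos.1 (show 0 < #(A \ A') by omega)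
    obtain ⟨hx1, hx2⟩ := Finset.mem_sdiff.1 hx
    obtain ⟨hy1, hy2⟩ := Finset.mem_sdiff.1 hy
    have hd : A' \ insert x (A.erase y) = (A' \ A).erase x := by
      ext z; simp only [mem_sdiff, mem_insert, mem_erase]; grind
    refine ih (h A hA x y hy1 hx2 (hR x hx y hy)) ?_ ?_ ?_
    · rw [Finset.card_insert_of_notMem (by simp [hx2]), Finset.card_erase_of_mem hy1, hc]
      have := Finset.card_pos.2 ⟨y, hy1⟩
      omega
    · intro u hu v hv
      apply hR <;> grind
    · rw [hd, Finset.card_erase_of_mem hx, hk]; rfl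

/-- Reflection of a sum whose weights are antisymmetric about `r / 2`. -/
theorem sum_mul_nonneg_of_antisymm {r : ℕ} {c w : ℕ → ℚ} (hw : ∀ p ≤ r, w (r - p) = -w p)
    (h : ∀ p ≤ r, r < 2 * p → 0 ≤ w p ∧ c (r - p) ≤ c p) :
    0 ≤ ∑ p ∈ range (r + 1), c p * w p ∧
    (∑ p ∈ range (r + 1), c p * w p = 0 → ∀ p ≤ r, (c p - c (r - p)) * w p = 0) := by
  have h1 : ∑ p ∈ range (r + 1), c p * w p = -∑ p ∈ range (r + 1), c (r - p) * w p := by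
    rw [← Finset.sum_range_reflect, ← Finset.sum_neg_distrib]
    refine Finset.sum_congr rfl fun p hp => ?_
    have hp' : p ≤ r := by simpa [Nat.lt_succ_iff] using hp
    rw [show r + 1 - 1 - p = r - p by omega, hw p hp']
    ring
  have h2 : 2 * ∑ p ∈ range (r + 1), c p * w p =
      ∑ p ∈ range (r + 1), (c p - c (r - p)) * w p := by
    simp only [sub_mul, Finset.sum_sub_distrib]
    linarith
  have h3 : ∀ p ∈ range (r + 1), 0 ≤ (c p - c (r - p)) * w p := by
    intro p hp
    have hp' : p ≤ r := by simpa [Nat.lt_succ_iff] using hp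
    rcases lt_trichotomy r (2 * p) with hlt | heq | hgt
    · obtain ⟨ha, hb⟩ := h p hp' hlt
      exact mul_nonneg (by linarith) ha
    · rw [show r - p = p by omega]; simp
    · obtain ⟨ha, hb⟩ := h (r - p) (by omega) (by omega)
      rw [hw p hp'] at ha
      rw [show r - (r - p) = p by omega] at hb
      exact mul_nonneg_of_nonpos_of_nonpos (by linarith) (by linarith)
  refine ⟨by linarith [Finset.sum_nonneg h3], fun h0 p hp => ?_⟩
  rw [h0, mul_zero] at h2
  exact (Finset.sum_eq_zero_iff_of_nonneg h3).1 h2.symm p (by simp; omega)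

theorem choose_mul_choose_sub_comm (N k l : ℕ) :
    N.choose k * (N - k).choose l = N.choose l * (N - l).choose k := by
  have h1 := Nat.choose_mul (n := N) (k := k + l) (s := k) (by omega)
  have h2 := Nat.choose_mul (n := N) (k := k + l) (s := l) (by omega)
  rw [Nat.add_sub_cancel_left] at h1
  rw [Nat.add_sub_cancel] at h2
  rw [← h1, ← h2, Nat.choose_symm_add]

/-! ### Complementary neighbours, layer by layer. -/

/-- The `q`-subsets of `U ∪ V` that are disjoint from some member of `𝒢` and contain the
complement of that member in `U`. -/
def complNbrs (U V : Finset ℕ) (𝒢 : Finset (Finset ℕ)) (q : ℕ) : Finset (Finset ℕ) :=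
  {D ∈ powersetCard q (U ∪ V) | ∃ C ∈ 𝒢, Disjoint C D ∧ U ⊆ C ∪ D}

/-- The trace of `D` on `U` is forced to be `U \ C`, and its trace on `V` is any `l`-subset of `V \
C`. -/
theorem card_filter_disjoint_cover {U V C : Finset ℕ} (hUV : Disjoint U V) {q l : ℕ}
    (hq : q = #(U \ C) + l) :
    #{D ∈ powersetCard q (U ∪ V) | Disjoint C D ∧ U ⊆ C ∪ D} = (#(V \ C)).choose l := by
  have hd : ∀ W, W ⊆ V \ C → Disjoint (U \ C) W := fun W hW =>
    (hUV.mono_left sdiff_subset).mono_right (hW.trans sdiff_subset)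
  have : ({D ∈ powersetCard q (U ∪ V) | Disjoint C D ∧ U ⊆ C ∪ D} : Finset (Finset ℕ)) =
      (powersetCard l (V \ C)).image (fun W => (U \ C) ∪ W) := by
    ext D
    simp only [mem_filter, mem_powersetCard, mem_image]
    constructor
    · rintro ⟨⟨h1, h2⟩, h3, h4⟩
      have hD : D = (U \ C) ∪ (D \ U) := by
        rw [Finset.disjoint_left] at h3
        ext z
        simp only [mem_union, mem_sdiff]
        have := @h4 z; have := @h3 z
        grind
      have hW : D \ U ⊆ V \ C := by
        rw [Finset.disjoint_left] at h3
        intro z hz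
        have := @h1 z; have := @h3 z
        grind
      refine ⟨D \ U, ⟨hW, ?_⟩, hD.symm⟩
      have := Finset.card_union_of_disjoint (hd _ hW)
      rw [← hD] at this
      omega
    · rintro ⟨W, ⟨hW, hl⟩, rfl⟩
      have hW' : ∀ z ∈ W, z ∈ V ∧ z ∉ C := fun z hz => by simpa using hW hz
      refine ⟨⟨?_, ?_⟩, ?_, ?_⟩
      · intro z hz; have := hW' z; grind
      · rw [Finset.card_union_of_disjoint (hd _ hW)]; omega
      · rw [Finset.disjoint_left]; intro z hz; have := hW' z; grind
      · intro z hz; grind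
  rw [this, Finset.card_image_of_injOn, Finset.card_powersetCard]
  intro W hW W' hW' he
  have e1 := hd W (Finset.mem_powersetCard.1 hW).1
  have e2 := hd W' (Finset.mem_powersetCard.1 hW').1
  have he' : (U \ C) ∪ W = (U \ C) ∪ W' := he
  have : ((U \ C) ∪ W) \ (U \ C) = ((U \ C) ∪ W') \ (U \ C) := by rw [he']
  rwa [Finset.union_sdiff_cancel_left e1, Finset.union_sdiff_cancel_left e2] at this

section

variable {U V : Finset ℕ} {𝒢 : Finset (Finset ℕ)} {β δ : ℕ}

theorem card_sdiff_eq_of_card_inter {U C : Finset ℕ} {j : ℕ} (h : #(C ∩ U) = j) :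
    #(U \ C) = #U - j := by
  rw [Finset.card_sdiff, h]

theorem card_sdiff_right_of_card_inter {C : Finset ℕ} (hUV : Disjoint U V) (hC : C ⊆ U ∪ V)
    {j : ℕ} (h : #(C ∩ U) = j) : #(V \ C) = #V - (#C - j) := by
  have : C ∩ V = C \ (C ∩ U) := by
    rw [Finset.disjoint_left] at hUV
    ext z; have := @hC z; have := @hUV z; grind
  rw [Finset.card_sdiff, this, Finset.card_sdiff_of_subset inter_subset_left, h]

/-- The relation between `C` and `D` is biregular between layer `j` and layer `#U - j`. The ratio of
the two degrees simplifies to a ratio of binomials of `#V` by `choose_mul_choose_sub_comm`. -/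
theorem layer_card_le (hUV : Disjoint U V) (h𝒢 : 𝒢 ⊆ powersetCard β (U ∪ V))
    (hβU : β ≤ #U) (hN : β + δ ≤ #V) {j : ℕ} (hj : j ≤ β) :
    #{C ∈ 𝒢 | #(C ∩ U) = j} * (#V).choose (δ + j) ≤
      #{D ∈ complNbrs U V 𝒢 (#U + δ) | #(D ∩ U) = #U - j} * (#V).choose (β - j) ∧
    (#{C ∈ 𝒢 | #(C ∩ U) = j} * (#V).choose (δ + j) =
      #{D ∈ complNbrs U V 𝒢 (#U + δ) | #(D ∩ U) = #U - j} * (#V).choose (β - j) →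
      ∀ C ∈ 𝒢, #(C ∩ U) = j → ∀ C' ∈ powersetCard β (U ∪ V),
        ∀ D ∈ powersetCard (#U + δ) (U ∪ V), Disjoint C D → U ⊆ C ∪ D → Disjoint C' D →
          U ⊆ C' ∪ D → C' ∈ 𝒢) := by
  have key := card_mul_le_card_mul_of_degrees (fun C D => Disjoint C D ∧ U ⊆ C ∪ D)
    (S := {C ∈ 𝒢 | #(C ∩ U) = j}) (Ω := powersetCard β (U ∪ V))
    (T := {D ∈ complNbrs U V 𝒢 (#U + δ) | #(D ∩ U) = #U - j})
    (x := (#V - (β - j)).choose (δ + j)) (y := (#V - (δ + j)).choose (β - j))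
    ((filter_subset _ _).trans h𝒢) ?_ ?_
  · obtain ⟨k1, k2⟩ := key
    have hp : 0 < (#V).choose (δ + j) := Nat.choose_pos (by omega)
    have hp' : 0 < (#V - (β - j)).choose (δ + j) := Nat.choose_pos (by omega)
    have hcomm := choose_mul_choose_sub_comm #V (β - j) (δ + j)
    set g := #{C ∈ 𝒢 | #(C ∩ U) = j}
    set f := #{D ∈ complNbrs U V 𝒢 (#U + δ) | #(D ∩ U) = #U - j}
    have e1 : g * (#V).choose (δ + j) * (#V - (β - j)).choose (δ + j) =
        g * (#V - (β - j)).choose (δ + j) * (#V).choose (δ + j) := by ring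
    have e2 : f * (#V).choose (β - j) * (#V - (β - j)).choose (δ + j) =
        f * (#V - (δ + j)).choose (β - j) * (#V).choose (δ + j) := by
      rw [mul_assoc, hcomm]; ring
    refine ⟨?_, ?_⟩
    · refine Nat.le_of_mul_le_mul_right ?_ hp'
      rw [e1, e2]
      exact Nat.mul_le_mul_right _ k1
    · intro h C hC hCj C' hC' D hD h1 h2 h3 h4
      have h5 := congrArg (· * (#V - (β - j)).choose (δ + j)) h
      simp only [e1, e2] at h5
      have h6 := k2 (Nat.eq_of_mul_eq_mul_right hp h5)
      refine (Finset.mem_filter.1 (h6 D ?_ C' hC' ⟨h3, h4⟩)).1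
      refine Finset.mem_filter.2 ⟨Finset.mem_filter.2 ⟨hD, C, hC, h1, h2⟩, ?_⟩
      rw [← card_sdiff_eq_of_card_inter hCj]
      congr 1
      rw [Finset.disjoint_left] at h1
      ext z; have := @h1 z; have := @h2 z; grind
  · intro C hC
    obtain ⟨hC, hCj⟩ := Finset.mem_filter.1 hC
    obtain ⟨hC1, hC2⟩ := Finset.mem_powersetCard.1 (h𝒢 hC)
    rw [← hC2, ← card_sdiff_right_of_card_inter hUV hC1 hCj,
      ← card_filter_disjoint_cover hUV (q := #U + δ)
        (by rw [card_sdiff_eq_of_card_inter hCj]; omega)]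
    refine Finset.card_le_card fun D hD => ?_
    obtain ⟨hD, h1, h2⟩ := Finset.mem_filter.1 hD
    refine Finset.mem_filter.2 ⟨Finset.mem_filter.2 ⟨Finset.mem_filter.2 ⟨hD, C, hC, h1, h2⟩, ?_⟩,
      h1, h2⟩
    rw [← card_sdiff_eq_of_card_inter hCj]
    congr 1
    rw [Finset.disjoint_left] at h1
    ext z; have := @h1 z; have := @h2 z; grind
  · intro D hD
    obtain ⟨hD, hDj⟩ := Finset.mem_filter.1 hD
    obtain ⟨hD1, hD2⟩ := Finset.mem_powersetCard.1 (Finset.mem_filter.1 hD).1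
    have e : #V - (δ + j) = #(V \ D) := by
      rw [card_sdiff_right_of_card_inter hUV hD1 hDj]; omega
    rw [e, ← card_filter_disjoint_cover hUV (q := β)
        (by rw [card_sdiff_eq_of_card_inter hDj]; omega)]
    simp only [disjoint_comm, union_comm]
    exact le_rfl

/-- Pairs of sets that differ by one move from `V` to `U` are counted: all moves up from layer `j`
stay in the family, while the moves down from layer `j + 1` are merely bounded. -/
theorem swap_card_le (hUV : Disjoint U V) (h𝒢 : 𝒢 ⊆ powersetCard β (U ∪ V)) {j : ℕ}
    (hswap : ∀ C ∈ 𝒢, #(C ∩ U) = j → ∀ x ∈ U \ C, ∀ y ∈ C ∩ V, insert x (C.erase y) ∈ 𝒢) :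
    #{C ∈ 𝒢 | #(C ∩ U) = j} * ((#U - j) * (β - j)) ≤
      #{C ∈ 𝒢 | #(C ∩ U) = j + 1} * ((j + 1) * (#V - (β - (j + 1)))) := by
  have hUV' : ∀ z, z ∈ U → z ∉ V := fun z hz => Finset.disjoint_left.1 hUV hz
  refine (card_mul_le_card_mul_of_degrees
    (fun C C' => ∃ x ∈ U \ C, ∃ y ∈ C ∩ V, C' = insert x (C.erase y)) subset_rfl ?_ ?_).1
  · intro C hC
    obtain ⟨hC, hCj⟩ := Finset.mem_filter.1 hC
    obtain ⟨hC1, hC2⟩ := Finset.mem_powersetCard.1 (h𝒢 hC)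
    have hcV : #(C ∩ V) = β - j := by
      have : C ∩ V = C \ (C ∩ U) := by
        ext z; have := @hC1 z; have := hUV' z; grind
      rw [this, Finset.card_sdiff_of_subset inter_subset_left, hCj, hC2]
    rw [← card_sdiff_eq_of_card_inter hCj, ← hcV, ← Finset.card_product]
    refine Finset.card_le_card_of_injOn (fun p => insert p.1 (C.erase p.2)) ?_ ?_
    · rintro ⟨x, y⟩ hp
      simp only [coe_product, Set.mem_prod, mem_coe] at hp
      obtain ⟨hx, hy⟩ := hp
      refine Finset.mem_filter.2 ⟨Finset.mem_filter.2 ⟨hswap C hC hCj x hx y hy, ?_⟩,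
        x, hx, y, hy, rfl⟩
      have : insert x (C.erase y) ∩ U = insert x (C ∩ U) := by
        ext z; have := hUV' z; grind
      show #(insert x (C.erase y) ∩ U) = j + 1
      rw [this, Finset.card_insert_of_notMem (by grind), hCj]
    · rintro ⟨x, y⟩ hp ⟨x', y'⟩ hp' he
      simp only [coe_product, Set.mem_prod, mem_coe] at hp hp'
      simp only [Finset.ext_iff] at he
      have h1 := he x; have h2 := he x'; have h3 := he y; have h4 := he y'
      have := hUV' x; have := hUV' x'
      simp only [Prod.mk.injEq]
      grind
  · intro C' hC'
    obtain ⟨hC, hCj⟩ := Finset.mem_filter.1 hC'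
    obtain ⟨hC1, hC2⟩ := Finset.mem_powersetCard.1 (h𝒢 hC)
    have e := card_sdiff_right_of_card_inter hUV hC1 hCj
    rw [← hC2, ← e]
    have e2 : (j + 1) * #(V \ C') = #((C' ∩ U) ×ˢ (V \ C')) := by
      rw [Finset.card_product, hCj]
    rw [e2]
    refine (Finset.card_le_card ?_).trans (Finset.card_image_le
      (f := fun p : ℕ × ℕ => insert p.2 (C'.erase p.1)))
    intro C hC
    obtain ⟨hC, x, hx, y, hy, rfl⟩ := Finset.mem_filter.1 hC
    refine Finset.mem_image.2 ⟨(x, y), ?_, ?_⟩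
    · simp only [mem_product]
      have := hUV' x
      grind
    · have := hUV' x
      ext z; grind

end

/-! ### Weighted layer sums and the inequality for complementary neighbours. -/

section

/-- With `r = β - δ` the weights change sign under `j ↦ r - j`, so the indices up to `r` are paired
and the larger ones have nonnegative weight. For a vanishing sum, index `β - 1` must not lie beyond
`r`, whence `δ ≤ 1`, and it must balance its mirror image `1 - δ`. -/
theorem sum_layers_nonneg {β δ N : ℕ} {c : ℕ → ℚ} (hc : ∀ j, 0 ≤ c j)
    (hmono : ∀ i j, i ≤ j → j < β → i + j ≤ β → c i ≤ c j) (hβ : c β = 0)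
    (h0 : δ = 0 → c 0 = 0) (hN : β + δ ≤ N) :
    0 ≤ ∑ j ∈ range (β + 1), c j * ((N.choose (δ + j) : ℚ) - N.choose (β - j)) ∧
    (β + δ < N → ∑ j ∈ range (β + 1), c j * ((N.choose (δ + j) : ℚ) - N.choose (β - j)) = 0 →
      1 ≤ β → 0 < c (β - 1) → δ ≤ 1 ∧ c (β - 1) = c (1 - δ)) := by
  set w : ℕ → ℚ := fun j => (N.choose (δ + j) : ℚ) - N.choose (β - j) with hw
  have hw0 : ∀ j ≤ β, β - j ≤ δ + j → 0 ≤ w j := fun j _ h => by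
    simp only [hw, sub_nonneg, Nat.cast_le]
    exact choose_le_choose_of_add_le h (by omega)
  have hw1 : ∀ j ≤ β, β + δ < N → β - j < δ + j → 0 < w j := fun j _ h' h => by
    simp only [hw, sub_pos, Nat.cast_lt]
    exact choose_lt_choose_of_add_lt h (by omega)
  change 0 ≤ ∑ j ∈ range (β + 1), c j * w j ∧
    (β + δ < N → ∑ j ∈ range (β + 1), c j * w j = 0 → _)
  by_cases hδ : δ ≤ β
  · obtain ⟨r, rfl⟩ := Nat.exists_eq_add_of_le hδ
    have hr := sum_mul_nonneg_of_antisymm (r := r) (c := c) (w := w) ?_ ?_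
    · have hI : ∀ j ∈ Ico (r + 1) (δ + r + 1), 0 ≤ c j * w j := fun j hj => by
        obtain ⟨h1, h2⟩ := Finset.mem_Ico.1 hj
        exact mul_nonneg (hc j) (hw0 j (by omega) (by omega))
      have hsplit := Finset.sum_range_add_sum_Ico (fun j => c j * w j)
        (show r + 1 ≤ δ + r + 1 by omega)
      have hI0 := Finset.sum_nonneg hI
      refine ⟨by linarith [hr.1], fun hlt hS h1 hpos => ?_⟩
      have hS2 := (Finset.sum_eq_zero_iff_of_nonneg hI).1 (by linarith [hr.1])
      have hS1 := hr.2 (by linarith [hr.1])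
      have hδ1 : δ ≤ 1 := by
        by_contra hδ1
        have h2 := hS2 (δ + r - 1) (Finset.mem_Ico.2 ⟨by omega, by omega⟩)
        have h3 := hw1 (δ + r - 1) (by omega) hlt (by omega)
        exact (mul_pos hpos h3).ne' h2
      refine ⟨hδ1, ?_⟩
      have h2 := hS1 (δ + r - 1) (by omega)
      rw [show r - (δ + r - 1) = 1 - δ by omega] at h2
      rcases mul_eq_zero.1 h2 with h2 | h2
      · linarith
      · by_cases h3 : δ + r - 1 = 1 - δ
        · rw [h3]
        · by_cases h4 : δ + r = 1
          · rw [h4] at hpos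
            rw [h0 (by omega)] at hpos
            exact absurd hpos (lt_irrefl _)
          · exact absurd h2 (hw1 (δ + r - 1) (by omega) hlt (by omega)).ne'
    · intro p hp
      simp only [hw]
      rw [show δ + (r - p) = δ + r - p by omega, show δ + r - (r - p) = δ + p by omega]
      ring
    · intro p hp hlt
      refine ⟨hw0 p (by omega) (by omega), ?_⟩
      rcases Nat.lt_or_ge p (δ + r) with h | h
      · exact hmono _ _ (by omega) h (by omega)
      -- Monotonicity is not available at index `β`. It occurs here only for `δ = 0`, and its mirror
      -- image 0 then has coefficient zero.
      · rw [show r - p = 0 by omega, h0 (by omega)]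
        exact hc p
  -- For `δ > β` every weight is nonnegative and no pairing is needed.
  · have hI : ∀ j ∈ range (β + 1), 0 ≤ c j * w j := fun j hj => by
      have := Finset.mem_range.1 hj
      exact mul_nonneg (hc j) (hw0 j (by omega) (by omega))
    refine ⟨Finset.sum_nonneg hI, fun hlt hS h1 hpos => ?_⟩
    have h2 := (Finset.sum_eq_zero_iff_of_nonneg hI).1 hS (β - 1) (Finset.mem_range.2 (by omega))
    exact absurd h2 (mul_pos hpos (hw1 (β - 1) (by omega) hlt (by omega))).ne'

variable {U V : Finset ℕ} {𝒢 : Finset (Finset ℕ)} {β δ : ℕ}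

/-- The quotients are the densities of the layers among all `β`-sets with the same trace size. One
step is `swap_card_le` rewritten with `Nat.choose_succ_right_eq`. -/
theorem layer_density_mono (hUV : Disjoint U V) (h𝒢 : 𝒢 ⊆ powersetCard β (U ∪ V))
    (hβU : β ≤ #U) (hβV : β ≤ #V)
    (hswap : ∀ C ∈ 𝒢, #(C ∩ U) + 1 < β → ∀ x ∈ U \ C, ∀ y ∈ C ∩ V, insert x (C.erase y) ∈ 𝒢)
    {i j : ℕ} (hij : i ≤ j) (hj : j < β) :
    (#{C ∈ 𝒢 | #(C ∩ U) = i} : ℚ) / (#V).choose (β - i) / (#U).choose i ≤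
      (#{C ∈ 𝒢 | #(C ∩ U) = j} : ℚ) / (#V).choose (β - j) / (#U).choose j := by
  induction j, hij using Nat.le_induction with
  | base => exact le_rfl
  | succ j hij ih =>
    refine (ih (by omega)).trans ?_
    have h1 := swap_card_le hUV h𝒢 (j := j) (fun C hC hCj => hswap C hC (by omega))
    have h2 := Nat.choose_succ_right_eq #V (β - (j + 1))
    have h3 := Nat.choose_succ_right_eq #U j
    rw [show β - (j + 1) + 1 = β - j by omega] at h2
    have p1 : 0 < (#V).choose (β - j) := Nat.choose_pos (by omega)
    have p2 : 0 < (#V).choose (β - (j + 1)) := Nat.choose_pos (by omega)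
    have p3 : 0 < (#U).choose j := Nat.choose_pos (by omega)
    have p4 : 0 < (#U).choose (j + 1) := Nat.choose_pos (by omega)
    have p5 : 0 < (#U - j) * (β - j) := Nat.mul_pos (by omega) (by omega)
    have p6 : 0 < #U - j := by omega
    have p7 : 0 < β - j := by omega
    rw [div_div, div_div, div_le_div_iff₀ (by positivity) (by positivity)]
    norm_cast
    refine Nat.le_of_mul_le_mul_right ?_ p5
    set g := #{C ∈ 𝒢 | #(C ∩ U) = j}
    set g' := #{C ∈ 𝒢 | #(C ∩ U) = j + 1}
    calc g * ((#V).choose (β - (j + 1)) * (#U).choose (j + 1)) * ((#U - j) * (β - j))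
        = g * ((#U - j) * (β - j)) * ((#V).choose (β - (j + 1)) * (#U).choose (j + 1)) := by ring
      _ ≤ g' * ((j + 1) * (#V - (β - (j + 1)))) *
          ((#V).choose (β - (j + 1)) * (#U).choose (j + 1)) := Nat.mul_le_mul_right _ h1
      _ = g' * (((#V).choose (β - (j + 1)) * (#V - (β - (j + 1)))) *
          ((#U).choose (j + 1) * (j + 1))) := by ring
      _ = g' * ((#V).choose (β - j) * (#U).choose j) * ((#U - j) * (β - j)) := by
          rw [← h2, h3]; ring

/-- Equality in every layer puts all neighbours of each `D` into `𝒢`, and two sets that differ by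
one exchange inside `V` have a common neighbour. -/
theorem exchange_right_of_layer_eq (hUV : Disjoint U V) (h𝒢 : 𝒢 ⊆ powersetCard β (U ∪ V))
    (hβU : β ≤ #U) (hN : β + δ < #V)
    (heq : ∀ j ≤ β, #{C ∈ 𝒢 | #(C ∩ U) = j} * (#V).choose (δ + j) =
      #{D ∈ complNbrs U V 𝒢 (#U + δ) | #(D ∩ U) = #U - j} * (#V).choose (β - j))
    {C C' : Finset ℕ} (hC : C ∈ 𝒢) (hC' : C' ⊆ U ∪ V) (hcard : #C' = β) (hU : C' ∩ U = C ∩ U) :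
    C' ∈ 𝒢 := by
  have hUV' : ∀ z, z ∈ U → z ∉ V := fun z hz => Finset.disjoint_left.1 hUV hz
  have hCs := h𝒢 hC
  rw [Finset.mem_powersetCard] at hCs
  refine mem_of_exchange (R := fun x y => x ∈ V ∧ y ∈ V) ?_ hC (by omega) ?_
  · clear! C
    rintro C hC x y hy hx ⟨hxV, hyV⟩
    obtain ⟨hC1, hC2⟩ := Finset.mem_powersetCard.1 (h𝒢 hC)
    set j := #(C ∩ U) with hj
    have hjβ : j ≤ β := hC2 ▸ Finset.card_le_card inter_subset_left
    have e := card_sdiff_right_of_card_inter hUV hC1 hj.symm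
    have e1 : #((V \ C).erase x) = #V - (#C - j) - 1 := by
      rw [Finset.card_erase_of_mem (by simp [hx, hxV]), e]
    -- The strict inequality `β + δ < #V` leaves room to avoid `x` as well, so that `(U \ C) ∪ W` is
    -- adjacent to `C` both before and after the exchange.
    obtain ⟨W, hW, hWc⟩ := Finset.exists_subset_card_eq
      (show δ + j ≤ #((V \ C).erase x) by omega)
    have hW' : ∀ z ∈ W, z ≠ x ∧ z ∈ V ∧ z ∉ C := fun z hz => by simpa using hW hz
    have hd : Disjoint (U \ C) W := by
      rw [Finset.disjoint_left]; intro z hz; have := hW' z; have := hUV' z; grind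
    refine (layer_card_le hUV h𝒢 hβU hN.le hjβ).2 (heq j hjβ) C hC hj.symm _ ?_
      ((U \ C) ∪ W) ?_ ?_ ?_ ?_ ?_
    · refine Finset.mem_powersetCard.2 ⟨?_, ?_⟩
      · intro z; have := @hC1 z; grind
      · rw [Finset.card_insert_of_notMem (by simp [hx]), Finset.card_erase_of_mem hy, hC2]
        have := Finset.card_pos.2 ⟨y, hy⟩
        omega
    · refine Finset.mem_powersetCard.2 ⟨?_, ?_⟩
      · intro z; have := hW' z; grind
      · rw [Finset.card_union_of_disjoint hd, card_sdiff_eq_of_card_inter hj.symm]; omega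
    · rw [Finset.disjoint_left]; intro z; have := hW' z; grind
    · intro z; grind
    · rw [Finset.disjoint_left]; intro z; have := hW' z; have := hUV' z; grind
    · intro z; have := hUV' z; grind
  · intro x hx y hy
    simp only [Finset.ext_iff, mem_inter] at hU
    have := hU x; have := hU y; have := @hC' x; have := @hCs.1 y
    grind

/-- A family of `β`-sets on `U ∪ V` that is closed under moving elements from `V` to `U` has at
least as many complementary neighbours as members. -/
theorem card_le_card_complNbrs (hUV : Disjoint U V) (h𝒢 : 𝒢 ⊆ powersetCard β (U ∪ V))
    (hβU : β ≤ #U) (hN : β + δ ≤ #V) (hlt : ∀ C ∈ 𝒢, #(C ∩ U) < β)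
    (hswap : ∀ C ∈ 𝒢, #(C ∩ U) + 1 < β → ∀ x ∈ U \ C, ∀ y ∈ C ∩ V, insert x (C.erase y) ∈ 𝒢)
    (h0 : δ = 0 → ∀ C ∈ 𝒢, (C ∩ U).Nonempty) :
    #𝒢 ≤ #(complNbrs U V 𝒢 (#U + δ)) ∧
    (β + δ < #V → #𝒢 = #(complNbrs U V 𝒢 (#U + δ)) → 𝒢.Nonempty →
      δ ≤ 1 ∧ (∃ C ∈ 𝒢, #(C ∩ U) = 1 - δ ∧
        ∀ C', C' ⊆ U ∪ V → #C' = β → C' ∩ U = C ∩ U → C' ∈ 𝒢) ∧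
      (δ = 0 → (#U).choose (β - 1) ≤ #U)) := by
  set 𝒩 := complNbrs U V 𝒢 (#U + δ) with h𝒩
  set g : ℕ → ℕ := fun j => #{C ∈ 𝒢 | #(C ∩ U) = j} with hg
  set f : ℕ → ℕ := fun j => #{D ∈ 𝒩 | #(D ∩ U) = #U - j} with hf
  set c : ℕ → ℚ := fun j => (g j : ℚ) / (#V).choose (β - j) with hc
  have pV : ∀ j, (0 : ℚ) < (#V).choose (β - j) := fun j => by
    exact_mod_cast Nat.choose_pos (by omega)
  have pU : ∀ j < β, (0 : ℚ) < (#U).choose j := fun j hj => by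
    exact_mod_cast Nat.choose_pos (by omega)
  have hcg : ∀ j, c j * (#V).choose (β - j) = g j := fun j => div_mul_cancel₀ _ (pV j).ne'
  have hc0 : ∀ j, 0 ≤ c j := fun j => div_nonneg (Nat.cast_nonneg _) (pV j).le
  have hgβ : g β = 0 := by
    rw [hg]
    simp only [Finset.card_eq_zero, Finset.filter_eq_empty_iff]
    intro C hC; exact (hlt C hC).ne
  have hμ : ∀ i j, i ≤ j → j < β → c i / (#U).choose i ≤ c j / (#U).choose j := fun i j hij hj =>
    layer_density_mono hUV h𝒢 hβU (by omega) hswap hij hj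
  -- Here `c j` is the density times `(#U).choose j`, and both factors grow because `i + j ≤ β ≤
  -- #U`.
  have hmono : ∀ i j, i ≤ j → j < β → i + j ≤ β → c i ≤ c j := by
    intro i j hij hj hs
    have h1 := hμ i j hij hj
    have h2 : ((#U).choose i : ℚ) ≤ (#U).choose j := by
      exact_mod_cast choose_le_choose_of_add_le hij (by omega)
    rw [div_le_div_iff₀ (pU i (by omega)) (pU j hj)] at h1
    exact le_of_mul_le_mul_right
      ((mul_le_mul_of_nonneg_left h2 (hc0 i)).trans h1) (pU i (by omega))
  have hlayer : ∀ j ≤ β, g j * (#V).choose (δ + j) ≤ f j * (#V).choose (β - j) := fun j hj =>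
    (layer_card_le hUV h𝒢 hβU hN hj).1
  have hfc : ∀ j ∈ range (β + 1), c j * (#V).choose (δ + j) ≤ f j := fun j hj => by
    have h1 := hlayer j (by simpa [Nat.lt_succ_iff] using hj)
    simp only [hc]
    rw [div_mul_eq_mul_div, div_le_iff₀ (pV j)]
    exact_mod_cast h1
  have hsg : #𝒢 = ∑ j ∈ range (β + 1), g j :=
    Finset.card_eq_sum_card_fiberwise fun C hC => by
      have := hlt C hC
      simp only [coe_range, Set.mem_Iio]; omega
  have hsf : ∑ j ∈ range (β + 1), f j ≤ #𝒩 := by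
    rw [hf, ← Finset.card_biUnion]
    · exact Finset.card_le_card (Finset.biUnion_subset.2 fun j _ => Finset.filter_subset _ _)
    · intro i hi j hj hij
      simp only [coe_range, Set.mem_Iio] at hi hj
      refine Finset.disjoint_left.2 fun D hD hD' => ?_
      have := (Finset.mem_filter.1 hD).2
      have := (Finset.mem_filter.1 hD').2
      omega
  have hkey := sum_layers_nonneg (N := #V) hc0 hmono (by simp [hc, hgβ])
    (fun h => by
      have : g 0 = 0 := by
        rw [hg]
        simp only [Finset.card_eq_zero, Finset.filter_eq_empty_iff]
        intro C hC; exact (h0 h C hC).ne_empty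
      simp [hc, this]) hN
  have hS : ∑ j ∈ range (β + 1), c j * (((#V).choose (δ + j) : ℚ) - (#V).choose (β - j)) =
      ∑ j ∈ range (β + 1), c j * (#V).choose (δ + j) - #𝒢 := by
    rw [hsg, Nat.cast_sum, ← Finset.sum_sub_distrib]
    exact Finset.sum_congr rfl fun j _ => by rw [mul_sub, hcg]
  have hle := Finset.sum_le_sum hfc
  have hsf' : ∑ j ∈ range (β + 1), (f j : ℚ) ≤ #𝒩 := by exact_mod_cast hsf
  refine ⟨?_, fun hNlt heq hne => ?_⟩
  · have : (#𝒢 : ℚ) ≤ #𝒩 := by linarith [hkey.1]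
    exact_mod_cast this
  have heq' : (#𝒢 : ℚ) = #𝒩 := by exact_mod_cast heq
  obtain ⟨C0, hC0⟩ := hne
  have hβ : 1 ≤ β := Nat.one_le_of_lt (hlt C0 hC0)
  -- Increasing density carries nonemptiness of any layer up to the last admissible one.
  have htop : 0 < c (β - 1) := by
    have h1 := hlt C0 hC0
    have h2 := hμ #(C0 ∩ U) (β - 1) (by omega) (by omega)
    have h3 : 0 < g #(C0 ∩ U) := Finset.card_pos.2 ⟨C0, by simp [hC0]⟩
    have h4 : 0 < c #(C0 ∩ U) := div_pos (by exact_mod_cast h3) (pV _)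
    have h5 := (div_pos h4 (pU _ h1)).trans_le h2
    have h6 := pU (β - 1) (by omega)
    exact (div_pos_iff_of_pos_right h6).1 h5
  obtain ⟨hδ, hcc⟩ := hkey.2 hNlt (by linarith [hkey.1]) hβ htop
  have hfeq := (Finset.sum_eq_sum_iff_of_le hfc).1 (by linarith [hkey.1])
  refine ⟨hδ, ?_, ?_⟩
  · have h1 : 0 < g (1 - δ) := by
      rw [Nat.pos_iff_ne_zero]
      intro h
      rw [hcc] at htop
      simp [hc, h] at htop
    obtain ⟨C, hC⟩ := Finset.card_pos.1 h1
    obtain ⟨hC, hCj⟩ := Finset.mem_filter.1 hC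
    refine ⟨C, hC, hCj, fun C' h1 h2 h3 => ?_⟩
    refine exchange_right_of_layer_eq hUV h𝒢 hβU hNlt (fun j hj => ?_) hC h1 h2 h3
    have h4 := hfeq j (Finset.mem_range.2 (by omega))
    have h5 : (g j : ℚ) * (#V).choose (δ + j) = f j * (#V).choose (β - j) := by
      rw [← h4, ← hcg]; ring
    exact_mod_cast h5
  · rintro rfl
    have h2β : 1 < β := by
      by_contra h
      have h1 : β = 1 := by omega
      subst h1
      have := hlt C0 hC0
      have := Finset.card_pos.2 (h0 rfl C0 hC0)
      omega
    -- For `δ = 0`, `c (β - 1) = c 1` is positive and cancels from the density inequality, which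
    -- leaves only the binomials of `#U`.
    have h1 := hμ 1 (β - 1) (by omega) (by omega)
    rw [hcc, div_le_div_iff₀ (pU 1 h2β) (pU _ (by omega))] at h1
    rw [hcc] at htop
    have h2 := le_of_mul_le_mul_left h1 htop
    simp only [Nat.choose_one_right] at h2
    exact_mod_cast h2

end

/-! ### Initial families and covering numbers. -/

theorem IsInitial.exchange {n : ℕ} {F : Finset (Finset ℕ)} (h : IsInitial n F) {A : Finset ℕ}
    (hA : A ∈ F) {x y : ℕ} (hy : y ∈ A) (hx : x ∉ A) (h1 : 1 ≤ x) (hxy : x < y) (hyn : y ≤ n) :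
    insert x (A.erase y) ∈ F := by
  by_contra hc
  have h2 : shiftSet x y F A ∈ shift x y F := Finset.mem_image_of_mem _ hA
  rw [h x y h1 hxy hyn, shiftSet, if_pos ⟨hy, hx, hc⟩] at h2
  exact hc h2

theorem IsInitial.mem_of_lt {n a : ℕ} {F : Finset (Finset ℕ)} (h : IsInitial n F)
    (hF : F ⊆ kSubsets (Icc 1 n) a) {A A' : Finset ℕ} (hA : A ∈ F) (hA' : A' ⊆ Icc 1 n)
    (hc : #A' = a) (hlt : ∀ x ∈ A' \ A, ∀ y ∈ A \ A', x < y) : A' ∈ F := by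
  obtain ⟨h1, h2⟩ := Finset.mem_powersetCard.1 (hF hA)
  refine mem_of_exchange (R := fun x y => 1 ≤ x ∧ x < y ∧ y ≤ n) ?_ hA (by omega) ?_
  · rintro C hC x y hy hx ⟨r1, r2, r3⟩
    exact h.exchange hC hy hx r1 r2 r3
  · intro x hx y hy
    have := Finset.mem_Icc.1 (hA' (Finset.mem_sdiff.1 hx).1)
    have := Finset.mem_Icc.1 (h1 (Finset.mem_sdiff.1 hy).1)
    exact ⟨by omega, hlt x hx y hy, by omega⟩

/-- An initial family with a member that avoids `[k]` contains all `a`-subsets of `[k + a]`. -/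
theorem IsInitial.mem_of_disjoint_Icc {n a k : ℕ} {F : Finset (Finset ℕ)} (h : IsInitial n F)
    (hF : F ⊆ kSubsets (Icc 1 n) a) {A A' : Finset ℕ} (hA : A ∈ F) (hd : Disjoint A (Icc 1 k))
    (hA' : A' ⊆ Icc 1 (k + a)) (hc : #A' = a) : A' ∈ F := by
  obtain ⟨h1, h2⟩ := Finset.mem_powersetCard.1 (hF hA)
  have hAk : ∀ x ∈ A, k + 1 ≤ x ∧ x ≤ n := fun x hx => by
    have h3 := Finset.mem_Icc.1 (h1 hx)
    have h4 := Finset.disjoint_left.1 hd hx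
    rw [Finset.mem_Icc] at h4
    omega
  have h3 : #A ≤ n - k := by
    have : A ⊆ Icc (k + 1) n := fun x hx => Finset.mem_Icc.2 (hAk x hx)
    have := Finset.card_le_card this
    rw [Nat.card_Icc] at this
    omega
  rcases Nat.eq_zero_or_pos a with rfl | ha
  · rw [Finset.card_eq_zero] at h2 hc
    rwa [hc, ← h2]
  -- The leftmost `a`-set beyond `[k]` is reached first; every `a`-subset of `[k + a]` is then
  -- obtained from it by left shifts.
  have hI : Icc (k + 1) (k + a) ∈ F := by
    refine h.mem_of_lt hF hA (Finset.Icc_subset_Icc (by omega) (by omega)) (by simp) ?_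
    intro x hx y hy
    simp only [mem_sdiff, mem_Icc] at hx hy
    have := hAk y hy.1
    omega
  refine h.mem_of_lt hF hI (hA'.trans (Finset.Icc_subset_Icc le_rfl (by omega))) hc ?_
  intro x hx y hy
  have := Finset.mem_Icc.1 (hA' (Finset.mem_sdiff.1 hx).1)
  simp only [mem_sdiff, mem_Icc] at hx hy
  omega

/-- A member that avoids `[#T]` would bring all `a`-subsets of `[#T + a]` into `F`, and one of these
avoids `T`. -/
theorem IsInitial.isCover_Icc {n a : ℕ} {F : Finset (Finset ℕ)} (h : IsInitial n F)
    (hF : F ⊆ kSubsets (Icc 1 n) a) {T : Finset ℕ} (hT : IsCover n F T) :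
    IsCover n F (Icc 1 #T) := by
  have hTn : #T ≤ n := by simpa using Finset.card_le_card hT.1
  refine ⟨Finset.Icc_subset_Icc le_rfl hTn, fun A hA => ?_⟩
  by_contra hne
  rw [Finset.not_nonempty_iff_eq_empty, ← Finset.disjoint_iff_inter_eq_empty] at hne
  obtain ⟨A', hA', hc⟩ := Finset.exists_subset_card_eq (s := Icc 1 (#T + a) \ T) (n := a) (by
    have := Finset.le_card_sdiff T (Icc 1 (#T + a))
    simp only [Nat.card_Icc] at this
    omega)
  have h1 := h.mem_of_disjoint_Icc hF hA hne.symm (hA'.trans sdiff_subset) hc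
  obtain ⟨x, hx⟩ := hT.2 A' h1
  rw [Finset.mem_inter] at hx
  exact (Finset.mem_sdiff.1 (hA' hx.2)).2 hx.1

theorem exists_disjoint_of_lt_coveringNumber {n k : ℕ} {F : Finset (Finset ℕ)} (hk : k ≤ n)
    (h : k < coveringNumber n F) : ∃ A ∈ F, Disjoint A (Icc 1 k) := by
  by_contra! hc
  have : IsCover n F (Icc 1 k) := by
    refine ⟨Finset.Icc_subset_Icc le_rfl hk, fun A hA => ?_⟩
    rw [Finset.inter_comm, ← Finset.not_disjoint_iff_nonempty_inter]
    exact hc A hA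
  have h1 : coveringNumber n F ≤ k := Nat.sInf_le ⟨_, this, by simp⟩
  omega

theorem exists_isCover_card_eq_coveringNumber {n a : ℕ} {F : Finset (Finset ℕ)}
    (hF : F ⊆ kSubsets (Icc 1 n) a) (ha : 1 ≤ a) :
    ∃ T, IsCover n F T ∧ #T = coveringNumber n F := by
  refine Nat.sInf_mem (s := {k : ℕ | ∃ T : Finset ℕ, IsCover n F T ∧ #T = k})
    ⟨_, Icc 1 n, ⟨subset_rfl, fun A hA => ?_⟩, rfl⟩
  obtain ⟨h1, h2⟩ := Finset.mem_powersetCard.1 (hF hA)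
  rw [Finset.inter_eq_right.2 h1]
  exact Finset.card_pos.1 (by omega)

/-! ### The size of the extremal family. -/

/-- The `a`-sets of the extremal family. -/
def extremalLeft (n a m s t : ℕ) : Finset (Finset ℕ) :=
  (kSubsets (Icc 1 n) a).filter (fun A => (A ∩ Icc 1 s).Nonempty ∧ t ≤ #(A ∩ Icc 1 m))

/-- The `b`-sets of the extremal family. -/
def extremalRight (n b m s : ℕ) : Finset (Finset ℕ) :=
  (kSubsets (Icc 1 n) b).filter (fun B => Icc 1 s ⊆ B) ∪ kSubsets (Icc 1 m) b

theorem extremal_eq_union (n a b s t : ℕ) :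
    extremal n a b s t = extremalLeft n a (b + t - 1) s t ∪ extremalRight n b (b + t - 1) s :=
  Finset.union_assoc _ _ _

theorem disjoint_of_subset_kSubsets {X Y : Finset ℕ} {a b : ℕ} {F G : Finset (Finset ℕ)}
    (hF : F ⊆ kSubsets X a) (hG : G ⊆ kSubsets Y b) (hab : a ≠ b) : Disjoint F G := by
  refine Finset.disjoint_left.2 fun A hA hA' => hab ?_
  rw [← (Finset.mem_powersetCard.1 (hF hA)).2, (Finset.mem_powersetCard.1 (hG hA')).2]

theorem extremalLeft_subset (n a m s t : ℕ) : extremalLeft n a m s t ⊆ kSubsets (Icc 1 n) a :=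
  Finset.filter_subset _ _

theorem extremalRight_subset {n b m : ℕ} (s : ℕ) (hm : m ≤ n) :
    extremalRight n b m s ⊆ kSubsets (Icc 1 n) b :=
  Finset.union_subset (Finset.filter_subset _ _)
    (Finset.powersetCard_mono (Finset.Icc_subset_Icc le_rfl hm))

theorem card_extremal {n a b s t : ℕ} (hm : b + t - 1 ≤ n) (hab : a ≠ b) :
    #(extremal n a b s t) =
      #(extremalLeft n a (b + t - 1) s t) + #(extremalRight n b (b + t - 1) s) := by
  rw [extremal_eq_union, Finset.card_union_of_disjoint]
  exact disjoint_of_subset_kSubsets (extremalLeft_subset _ _ _ _ _)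
    (extremalRight_subset _ hm) hab

theorem card_filter_card_inter_eq {U V : Finset ℕ} (hUV : Disjoint U V) {q i : ℕ} (hi : i ≤ q) :
    #{D ∈ powersetCard q (U ∪ V) | #(D ∩ U) = i} = (#U).choose i * (#V).choose (q - i) := by
  have hUV' : ∀ z, z ∈ U → z ∉ V := fun z hz => Finset.disjoint_left.1 hUV hz
  rw [← Finset.card_powersetCard i U, ← Finset.card_powersetCard (q - i) V,
    ← Finset.card_product]
  refine Finset.card_nbij' (fun D => (D ∩ U, D ∩ V)) (fun p => p.1 ∪ p.2) ?_ ?_ ?_ ?_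
  · intro D hD
    obtain ⟨hD, h3⟩ := Finset.mem_filter.1 hD
    obtain ⟨h1, h2⟩ := Finset.mem_powersetCard.1 hD
    have e : D ∩ V = D \ (D ∩ U) := by
      ext z; have := @h1 z; have := hUV' z; grind
    simp only [coe_product, Set.mem_prod, mem_coe, mem_powersetCard]
    refine ⟨⟨inter_subset_right, h3⟩, inter_subset_right, ?_⟩
    rw [e, Finset.card_sdiff_of_subset inter_subset_left, h2, h3]
  · rintro ⟨W, W'⟩ hp
    simp only [coe_product, Set.mem_prod, mem_coe, mem_powersetCard] at hp
    obtain ⟨⟨h1, h2⟩, h3, h4⟩ := hp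
    refine Finset.mem_filter.2 ⟨Finset.mem_powersetCard.2 ⟨Finset.union_subset_union h1 h3, ?_⟩, ?_⟩
    · rw [Finset.card_union_of_disjoint ((hUV.mono_left h1).mono_right h3)]; omega
    · rw [← h2]; congr 1
      ext z; have := @h1 z; have := @h3 z; have := hUV' z; grind
  · intro D hD
    obtain ⟨h1, h2⟩ := Finset.mem_powersetCard.1 (Finset.mem_filter.1 hD).1
    ext z; have := @h1 z; grind
  · rintro ⟨W, W'⟩ hp
    simp only [coe_product, Set.mem_prod, mem_coe, mem_powersetCard] at hp
    obtain ⟨⟨h1, -⟩, h3, -⟩ := hp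
    simp only [Prod.mk.injEq]
    constructor <;> (ext z; have := @h1 z; have := @h3 z; have := hUV' z; grind)

theorem card_filter_superset {X S : Finset ℕ} (hS : S ⊆ X) {b : ℕ} (hb : #S ≤ b) :
    #{B ∈ powersetCard b X | S ⊆ B} = (#X - #S).choose (b - #S) := by
  rw [← Finset.card_sdiff_of_subset hS, ← Finset.card_powersetCard]
  refine Finset.card_nbij' (fun B => B \ S) (fun C => C ∪ S) ?_ ?_ ?_ ?_
  · intro B hB
    obtain ⟨hB, h3⟩ := Finset.mem_filter.1 hB
    obtain ⟨h1, h2⟩ := Finset.mem_powersetCard.1 hB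
    refine Finset.mem_powersetCard.2 ⟨Finset.sdiff_subset_sdiff h1 subset_rfl, ?_⟩
    rw [Finset.card_sdiff_of_subset h3, h2]
  · intro C hC
    obtain ⟨h1, h2⟩ := Finset.mem_powersetCard.1 hC
    refine Finset.mem_filter.2 ⟨Finset.mem_powersetCard.2
      ⟨Finset.union_subset (h1.trans sdiff_subset) hS, ?_⟩, subset_union_right⟩
    rw [Finset.card_union_of_disjoint (Finset.disjoint_sdiff.symm.mono_left h1)]; omega
  · intro B hB
    exact Finset.sdiff_union_of_subset (Finset.mem_filter.1 hB).2
  · intro C hC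
    have h1 := (Finset.mem_powersetCard.1 hC).1
    exact Finset.union_sdiff_cancel_right (Finset.disjoint_sdiff.symm.mono_left h1)

theorem card_filter_le_card_inter {U V : Finset ℕ} (hUV : Disjoint U V) {q t : ℕ} (ht : t ≤ q) :
    (#{D ∈ powersetCard q (U ∪ V) | t ≤ #(D ∩ U)} : ℤ) =
      (#U + #V).choose q -
        ∑ i ∈ range t, ((#U).choose i : ℤ) * ((#V).choose (q - i) : ℤ) := by
  have h1 := Finset.card_filter_add_card_filter_not (s := powersetCard q (U ∪ V))
    (fun D => t ≤ #(D ∩ U))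
  rw [Finset.card_powersetCard, Finset.card_union_of_disjoint hUV] at h1
  have h2 : #{D ∈ powersetCard q (U ∪ V) | ¬ t ≤ #(D ∩ U)} =
      ∑ i ∈ range t, (#U).choose i * (#V).choose (q - i) := by
    rw [Finset.card_eq_sum_card_fiberwise (f := fun D => #(D ∩ U)) (t := range t)]
    · refine Finset.sum_congr rfl fun i hi => ?_
      have hi := Finset.mem_range.1 hi
      rw [← card_filter_card_inter_eq hUV (by omega), Finset.filter_filter]
      congr 1
      refine Finset.filter_congr fun D _ => ?_
      omega
    · intro D hD
      have := (Finset.mem_filter.1 hD).2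
      simp only [coe_range, Set.mem_Iio]; omega
  rw [h2] at h1
  have h3 : (#{D ∈ powersetCard q (U ∪ V) | t ≤ #(D ∩ U)} : ℤ) +
    ((∑ i ∈ range t, (#U).choose i * (#V).choose (q - i) : ℕ) : ℤ) = (#U + #V).choose q := by
    exact_mod_cast h1
  push_cast at h3
  linarith

theorem pairwiseDisjoint_image_insert {n s : ℕ} {f : ℕ → Finset (Finset ℕ)}
    (hf : ∀ i ∈ Icc 1 s, ∀ D ∈ f i, D ⊆ Icc (i + 1) n) :
    ((Icc 1 s : Finset ℕ) : Set ℕ).PairwiseDisjoint (fun i => (f i).image (insert i)) := by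
  intro i hi j hj hij
  refine Finset.disjoint_left.2 fun A hA hA' => hij ?_
  obtain ⟨D, hD, rfl⟩ := Finset.mem_image.1 hA
  obtain ⟨D', hD', he⟩ := Finset.mem_image.1 hA'
  have h1 := hf i hi D hD
  have h2 := hf j hj D' hD'
  have h3 : i ∈ insert j D' := by rw [he]; simp
  have h4 : j ∈ insert i D := by rw [← he]; simp
  rw [Finset.mem_insert] at h3 h4
  rcases h3 with h3 | h3
  · exact h3
  rcases h4 with h4 | h4
  · exact h4.symm
  have := Finset.mem_Icc.1 (h1 h4)
  have := Finset.mem_Icc.1 (h2 h3)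
  omega

theorem card_biUnion_image_insert {n s : ℕ} {f : ℕ → Finset (Finset ℕ)}
    (hf : ∀ i ∈ Icc 1 s, ∀ D ∈ f i, D ⊆ Icc (i + 1) n) :
    #((Icc 1 s).biUnion fun i => (f i).image (insert i)) = ∑ i ∈ Icc 1 s, #(f i) := by
  rw [Finset.card_biUnion (pairwiseDisjoint_image_insert hf)]
  refine Finset.sum_congr rfl fun i hi => Finset.card_image_of_injOn fun D hD D' hD' he => ?_
  have hn : ∀ D ∈ f i, i ∉ D := fun D hD h => by
    have := Finset.mem_Icc.1 (hf i hi D hD h)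
    omega
  rw [← Finset.erase_insert (hn D hD), ← Finset.erase_insert (hn D' hD'), he]

theorem Icc_union_Icc_succ {i m n : ℕ} (hi : i ≤ m) (hm : m ≤ n) :
    Icc (i + 1) m ∪ Icc (m + 1) n = Icc (i + 1) n := by
  ext z; simp only [mem_union, mem_Icc]; omega

theorem disjoint_Icc_Icc_succ (i m n : ℕ) : Disjoint (Icc i m) (Icc (m + 1) n) := by
  refine Finset.disjoint_left.2 fun z hz hz' => ?_
  rw [Finset.mem_Icc] at hz hz'
  omega

theorem exists_first_mem {s : ℕ} {A : Finset ℕ} (h : (A ∩ Icc 1 s).Nonempty) :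
    ∃ i ∈ Icc 1 s, i ∈ A ∧ ∀ x ∈ A, 1 ≤ x → i ≤ x := by
  refine ⟨(A ∩ Icc 1 s).min' h, ?_, ?_, fun x hx hx1 => ?_⟩
  · exact (Finset.mem_inter.1 (Finset.min'_mem _ h)).2
  · exact (Finset.mem_inter.1 (Finset.min'_mem _ h)).1
  · by_cases hxs : x ≤ s
    · exact Finset.min'_le _ _ (by simp [hx, hx1, hxs])
    · have := Finset.mem_Icc.1 (Finset.mem_inter.1 (Finset.min'_mem _ h)).2
      omega

/-- Sets are sorted by their least element `i ≤ s`. Removing it lowers the required intersection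
with `[m]` by one, hence `t - 1`. -/
theorem extremalLeft_eq_biUnion {n a m s t : ℕ} (ha : 1 ≤ a) (hs : s ≤ m) (hm : m ≤ n) :
    extremalLeft n a m s t = (Icc 1 s).biUnion fun i =>
      ({D ∈ powersetCard (a - 1) (Icc (i + 1) m ∪ Icc (m + 1) n) |
        t - 1 ≤ #(D ∩ Icc (i + 1) m)} : Finset (Finset ℕ)).image (insert i) := by
  ext A
  simp only [extremalLeft, kSubsets, mem_filter, mem_powersetCard, mem_biUnion, mem_image]
  constructor
  · rintro ⟨⟨h1, h2⟩, h3, h4⟩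
    obtain ⟨i, hi, hiA, hmin⟩ := exists_first_mem h3
    have hi' := Finset.mem_Icc.1 hi
    refine ⟨i, hi, A.erase i, ⟨⟨?_, ?_⟩, ?_⟩, Finset.insert_erase hiA⟩
    · rw [Icc_union_Icc_succ (by omega) hm]
      intro x hx
      obtain ⟨hne, hx⟩ := Finset.mem_erase.1 hx
      have := Finset.mem_Icc.1 (h1 hx)
      have := hmin x hx this.1
      exact Finset.mem_Icc.2 ⟨by omega, by omega⟩
    · rw [Finset.card_erase_of_mem hiA, h2]
    · have e : A.erase i ∩ Icc (i + 1) m = (A ∩ Icc 1 m).erase i := by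
        ext z
        have := hmin z
        simp only [mem_inter, mem_erase, mem_Icc]
        grind
      rw [e, Finset.card_erase_of_mem (by simp [hiA]; omega)]
      omega
  · rintro ⟨i, hi, D, ⟨⟨h1, h2⟩, h3⟩, rfl⟩
    have hi' := Finset.mem_Icc.1 hi
    rw [Icc_union_Icc_succ (by omega) hm] at h1
    have hD : ∀ x ∈ D, i + 1 ≤ x ∧ x ≤ n := fun x hx => Finset.mem_Icc.1 (h1 hx)
    have hiD : i ∉ D := fun h => by have := hD i h; omega
    refine ⟨⟨?_, ?_⟩, ⟨i, by simp [hi'.1, hi'.2]⟩, ?_⟩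
    · intro x hx
      rw [Finset.mem_insert] at hx
      rw [Finset.mem_Icc]
      have := hD x
      grind
    · rw [Finset.card_insert_of_notMem hiD, h2]; omega
    · have e : insert i D ∩ Icc 1 m = insert i (D ∩ Icc (i + 1) m) := by
        ext z
        have := hD z
        simp only [mem_inter, mem_insert, mem_Icc]
        grind
      rw [e, Finset.card_insert_of_notMem (by simp [hiD])]
      omega

theorem card_extremalLeft {n a m s t : ℕ} (ht : 2 ≤ t) (hta : t ≤ a) (hs : s ≤ m) (hm : m ≤ n) :
    (#(extremalLeft n a m s t) : ℤ) = ∑ j ∈ Icc 1 s, (((n - j).choose (a - 1) : ℤ) -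
      ∑ i ∈ Icc 0 (t - 2), ((m - j).choose i : ℤ) * ((n - m).choose (a - i - 1) : ℤ)) := by
  rw [extremalLeft_eq_biUnion (by omega) hs hm, card_biUnion_image_insert (n := n), Nat.cast_sum]
  · refine Finset.sum_congr rfl fun j hj => ?_
    have hj := Finset.mem_Icc.1 hj
    rw [card_filter_le_card_inter (disjoint_Icc_Icc_succ _ _ _) (by omega)]
    simp only [Nat.card_Icc]
    rw [show m + 1 - (j + 1) + (n + 1 - (m + 1)) = n - j by omega]
    congr 1
    refine Finset.sum_congr ?_ fun i _ => ?_
    · ext i; simp only [mem_range, mem_Icc]; omega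
    · rw [show m + 1 - (j + 1) = m - j by omega, show n + 1 - (m + 1) = n - m by omega,
        show a - 1 - i = a - i - 1 by omega]
  · intro i hi D hD
    have hi := Finset.mem_Icc.1 hi
    rw [← Icc_union_Icc_succ (show i ≤ m by omega) hm]
    exact (Finset.mem_powersetCard.1 (Finset.mem_filter.1 hD).1).1

theorem card_extremalRight {n b m s : ℕ} (hsb : s ≤ b) (hs : s ≤ m) (hm : m ≤ n) :
    (#(extremalRight n b m s) : ℤ) =
      ((n - s).choose (b - s) : ℤ) + (m.choose b : ℤ) - ((m - s).choose (b - s) : ℤ) := by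
  have h1 := Finset.card_union_add_card_inter
    ((kSubsets (Icc 1 n) b).filter (fun B => Icc 1 s ⊆ B)) (kSubsets (Icc 1 m) b)
  have h2 : (kSubsets (Icc 1 n) b).filter (fun B => Icc 1 s ⊆ B) ∩ kSubsets (Icc 1 m) b =
      (kSubsets (Icc 1 m) b).filter (fun B => Icc 1 s ⊆ B) := by
    have h3 : kSubsets (Icc 1 m) b ⊆ kSubsets (Icc 1 n) b :=
      Finset.powersetCard_mono (Finset.Icc_subset_Icc le_rfl hm)
    ext B
    have := @h3 B
    simp only [mem_inter, mem_filter]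
    tauto
  rw [h2, card_filter_superset (X := Icc 1 n) (Finset.Icc_subset_Icc le_rfl (by omega))
      (by simpa using hsb),
    card_filter_superset (X := Icc 1 m) (Finset.Icc_subset_Icc le_rfl hs) (by simpa using hsb),
    Finset.card_powersetCard] at h1
  simp only [Nat.card_Icc, Nat.add_sub_cancel] at h1
  rw [extremalRight]
  omega

/-! ### Classes by first missing element. -/

section

/-- The members of `G` whose first missing element is `i`, without their elements in `[i - 1]`,
except those inside `[m]`. -/
def firstMissing (n b m : ℕ) (G : Finset (Finset ℕ)) (i : ℕ) : Finset (Finset ℕ) :=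
  {C ∈ powersetCard (b - (i - 1)) (Icc (i + 1) m ∪ Icc (m + 1) n) |
    Icc 1 (i - 1) ∪ C ∈ G ∧ ¬ C ⊆ Icc (i + 1) m}

variable {n a b m s t i : ℕ} {F G : Finset (Finset ℕ)}

theorem card_sdiff_extremalRight_le (hG : G ⊆ kSubsets (Icc 1 n) b) (hs : s ≤ m) (hm : m ≤ n) :
    #(G \ extremalRight n b m s) ≤ ∑ i ∈ Icc 1 s, #(firstMissing n b m G i) := by
  have hsub : G \ extremalRight n b m s ⊆ (Icc 1 s).biUnion fun i =>
      (firstMissing n b m G i).image (Icc 1 (i - 1) ∪ ·) := by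
    intro B hB
    obtain ⟨hB, hBr⟩ := Finset.mem_sdiff.1 hB
    obtain ⟨h1, h2⟩ := Finset.mem_powersetCard.1 (hG hB)
    simp only [extremalRight, kSubsets, mem_union, mem_filter, mem_powersetCard, not_or,
      not_and] at hBr
    have h3 : ((Icc 1 n \ B) ∩ Icc 1 s).Nonempty := by
      obtain ⟨x, hx, hxB⟩ := Finset.not_subset.1 (hBr.1 ⟨h1, h2⟩)
      have := Finset.mem_Icc.1 hx
      refine ⟨x, ?_⟩
      simp only [mem_inter, mem_sdiff, mem_Icc]
      exact ⟨⟨⟨by omega, by omega⟩, hxB⟩, this⟩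
    obtain ⟨i, hi, hiB, hmin⟩ := exists_first_mem h3
    have hi' := Finset.mem_Icc.1 hi
    have hiB := (Finset.mem_sdiff.1 hiB).2
    have hpre : Icc 1 (i - 1) ⊆ B := by
      intro x hx
      by_contra hxB
      have hx := Finset.mem_Icc.1 hx
      have := hmin x (by simp only [mem_sdiff, mem_Icc]; exact ⟨⟨by omega, by omega⟩, hxB⟩) hx.1
      omega
    have hu : Icc 1 (i - 1) ∪ B \ Icc 1 (i - 1) = B := Finset.union_sdiff_of_subset hpre
    refine Finset.mem_biUnion.2 ⟨i, hi, Finset.mem_image.2 ⟨B \ Icc 1 (i - 1), ?_, hu⟩⟩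
    refine Finset.mem_filter.2 ⟨Finset.mem_powersetCard.2 ⟨?_, ?_⟩, by rwa [hu], ?_⟩
    · rw [Icc_union_Icc_succ (by omega) hm]
      intro x hx
      obtain ⟨hx, hx'⟩ := Finset.mem_sdiff.1 hx
      have := Finset.mem_Icc.1 (h1 hx)
      have : x ≠ i := fun h => hiB (h ▸ hx)
      rw [Finset.mem_Icc] at hx' ⊢
      omega
    · rw [Finset.card_sdiff_of_subset hpre, h2, Nat.card_Icc]; omega
    · intro h
      refine hBr.2 ?_ h2
      rw [← hu]
      exact Finset.union_subset (Finset.Icc_subset_Icc le_rfl (by omega))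
        (h.trans (Finset.Icc_subset_Icc (by omega) le_rfl))
  refine (Finset.card_le_card hsub).trans (Finset.card_biUnion_le.trans ?_)
  exact Finset.sum_le_sum fun i _ => Finset.card_image_le

/-- If `D` is a complementary neighbour of `C`, then `{i} ∪ D` is disjoint from `[i-1] ∪ C ∈ G` and
so is not in `F`. The sets `{i} ∪ D` have least element `i`, so different classes do not overlap. -/
theorem sum_card_complNbrs_le (hFG : CrossIntersecting F G) (hs : s ≤ b)
    (ht : 2 ≤ t) (hma : b + t - 1 ≤ a) (hm : b + t - 1 ≤ n) :
    ∑ i ∈ Icc 1 s, #(complNbrs (Icc (i + 1) (b + t - 1)) (Icc (b + t - 1 + 1) n)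
      (firstMissing n b (b + t - 1) G i) (a - 1)) ≤
      #(extremalLeft n a (b + t - 1) s t \ F) := by
  rw [← card_biUnion_image_insert (n := n)]
  · refine Finset.card_le_card fun A hA => ?_
    obtain ⟨i, hi, hA⟩ := Finset.mem_biUnion.1 hA
    obtain ⟨D, hD, rfl⟩ := Finset.mem_image.1 hA
    obtain ⟨hD, C, hC, hCD, hU⟩ := Finset.mem_filter.1 hD
    obtain ⟨hC, hCG, hCm⟩ := Finset.mem_filter.1 hC
    have hi' := Finset.mem_Icc.1 hi
    obtain ⟨hC1, hC2⟩ := Finset.mem_powersetCard.1 hC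
    refine Finset.mem_sdiff.2 ⟨?_, fun hF => ?_⟩
    · rw [extremalLeft_eq_biUnion (by omega) (by omega) hm]
      refine Finset.mem_biUnion.2 ⟨i, hi, Finset.mem_image_of_mem _ (Finset.mem_filter.2 ⟨hD, ?_⟩)⟩
      have h1 : Icc (i + 1) (b + t - 1) \ C ⊆ D ∩ Icc (i + 1) (b + t - 1) := by
        intro x hx
        have := @hU x
        grind
      have h2 := Finset.card_le_card h1
      -- As `C` is not inside `U`, it has at most `b - i` elements there, and `D` receives at least
      -- `(b + t - 1 - i) - (b - i) = t - 1`.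
      have h3 : #(C ∩ Icc (i + 1) (b + t - 1)) < #C :=
        Finset.card_lt_card ⟨inter_subset_left, fun h => hCm (h.trans inter_subset_right)⟩
      rw [Finset.card_sdiff, Nat.card_Icc] at h2
      omega
    · obtain ⟨x, hx⟩ := hFG _ hF _ hCG
      rw [Icc_union_Icc_succ (by omega) hm] at hC1
      have hD1 := (Finset.mem_powersetCard.1 hD).1
      rw [Icc_union_Icc_succ (by omega) hm] at hD1
      have h1 := @hC1 x
      have h2 := @hD1 x
      have h3 : x ∈ C → x ∉ D := fun h => Finset.disjoint_left.1 hCD h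
      simp only [mem_inter, mem_insert, mem_union, mem_Icc] at hx h1 h2
      rcases hx with ⟨rfl | hx, hx' | hx'⟩
      · omega
      · have := h1 hx'; omega
      · have := h2 hx; omega
      · exact h3 hx' hx
  · intro i hi D hD
    have hi := Finset.mem_Icc.1 hi
    rw [← Icc_union_Icc_succ (show i ≤ b + t - 1 by omega) hm]
    exact (Finset.mem_powersetCard.1 (Finset.mem_filter.1 hD).1).1

theorem firstMissing_card_le (hGi : IsInitial n G)
    (hFG : CrossIntersecting F G) (hF : ∀ A ⊆ Icc 1 (s - 1 + a), #A = a → A ∈ F)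
    (hs : s ≤ b) (ht : 2 ≤ t) (hma : b + t - 1 ≤ a) (hn : a + b ≤ n) (hi : i ∈ Icc 1 s) :
    #(firstMissing n b (b + t - 1) G i) ≤
      #(complNbrs (Icc (i + 1) (b + t - 1)) (Icc (b + t - 1 + 1) n)
        (firstMissing n b (b + t - 1) G i) (a - 1)) ∧
    (a + b < n → ¬ (s = 1 ∧ a = b + t - 1 ∧ 2 ≤ b ∧ (b = 2 ∨ t = 2)) →
      #(firstMissing n b (b + t - 1) G i) =
      #(complNbrs (Icc (i + 1) (b + t - 1)) (Icc (b + t - 1 + 1) n)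
        (firstMissing n b (b + t - 1) G i) (a - 1)) →
      firstMissing n b (b + t - 1) G i = ∅) := by
  have hi' := Finset.mem_Icc.1 hi
  set m := b + t - 1 with hm
  set U := Icc (i + 1) m with hU
  set V := Icc (m + 1) n with hV
  set β := b - (i - 1) with hβ
  have hUV : Disjoint U V := disjoint_Icc_Icc_succ _ _ _
  have hun : U ∪ V = Icc (i + 1) n := Icc_union_Icc_succ (by omega) (by omega)
  have hcU : #U = m - i := by rw [hU, Nat.card_Icc]; omega
  have hcV : #V = n - m := by rw [hV, Nat.card_Icc]; omega
  have hmem : ∀ C, C ∈ firstMissing n b m G i ↔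
      (C ⊆ Icc (i + 1) n ∧ #C = β) ∧ Icc 1 (i - 1) ∪ C ∈ G ∧ ¬ C ⊆ U := fun C => by
    rw [← hun, ← Finset.mem_powersetCard]; exact Finset.mem_filter
  -- The value of `δ` is dictated by `#U + δ = a - 1`; then `β + δ ≤ #V` is exactly `a + b ≤ n`.
  have key := card_le_card_complNbrs (U := U) (V := V) (𝒢 := firstMissing n b m G i) (β := β)
    (δ := a - m + (i - 1)) hUV (Finset.filter_subset _ _) (by omega) (by omega) ?_ ?_ ?_
  · rw [show #U + (a - m + (i - 1)) = a - 1 by omega] at key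
    refine ⟨key.1, fun hlt hex heq => ?_⟩
    by_contra hne
    obtain ⟨hδ, ⟨C, hC, hCU, hall⟩, hbin⟩ :=
      key.2 (by omega) heq (Finset.nonempty_iff_ne_empty.2 hne)
    obtain ⟨⟨hC1, hC2⟩, hCG, hCm⟩ := (hmem C).1 hC
    -- Since `δ ≤ 1`, only two cases remain: `δ = 0`, which means `i = 1` and `a = m`, and `δ = 1`.
    rcases Nat.eq_zero_or_pos (a - m + (i - 1)) with h0 | hpos
    · have hi1 : i = 1 := by omega
      have ham : a = m := by omega
      subst hi1
      rw [h0] at hCU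
      obtain ⟨u, hu⟩ := Finset.card_eq_one.1 hCU
      have huU : u ∈ C ∩ U := by rw [hu]; simp
      have hu2 := Finset.mem_Icc.1 (Finset.mem_inter.1 huU).2
      have hb2 : 2 ≤ b := by
        have h3 : #(C ∩ U) < #C :=
          Finset.card_lt_card ⟨inter_subset_left, fun h => hCm (h.trans inter_subset_right)⟩
        omega
      by_cases hs1 : s = 1
      · have h1 := hbin h0
        rw [hcU, show β - 1 = b - 1 by omega] at h1
        -- With `b = 2` and `t = 2` excluded, `2 ≤ b - 1 ≤ (m - 1) - 2`, so the binomial exceeds `m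
        -- - 1`.
        have h2 := lt_choose_of_two_le (M := m - 1) (j := b - 1) (by omega) (by omega)
        omega
      -- The elements in `V` may be pushed to the far right. Shifting `u` to 1 then gives a member
      -- of `G` disjoint from `[2, a + 1]`, which is in `F` because `s ≥ 2`.
      · have h1 := hall (insert u (Icc (n - b + 2) n)) ?_ ?_ ?_
        · obtain ⟨-, h2, -⟩ := (hmem _).1 h1
          simp only [Nat.sub_self, Finset.Icc_eq_empty_of_lt Nat.zero_lt_one,
            Finset.empty_union] at h2
          have h3 := hGi.exchange h2 (x := 1) (y := u) (by simp)
            (by simp only [mem_insert, mem_Icc]; omega) le_rfl (by omega) (by omega)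
          have h4 := hF (Icc 2 (a + 1)) (Finset.Icc_subset_Icc (by omega) (by omega)) (by simp)
          obtain ⟨x, hx⟩ := hFG _ h4 _ h3
          simp only [mem_inter, mem_insert, mem_erase, mem_Icc] at hx
          omega
        · rw [hun]
          intro x hx
          simp only [mem_insert, mem_Icc] at hx ⊢
          omega
        · rw [Finset.card_insert_of_notMem (by simp only [mem_Icc]; omega), Nat.card_Icc]
          omega
        · rw [hu]
          ext x
          simp only [mem_inter, mem_insert, mem_Icc, mem_singleton, hU]
          omega
    -- For `δ = 1` the trace on `U` is empty, so the last `β` points form a member of the class;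
    -- with `[i-1]` added they miss `[i, i - 1 + a] ∈ F`.
    · have h1 := hall (Icc (n - β + 1) n) ?_ ?_ ?_
      · obtain ⟨-, h2, -⟩ := (hmem _).1 h1
        have h4 := hF (Icc i (i - 1 + a)) (Finset.Icc_subset_Icc (by omega) (by omega))
          (by rw [Nat.card_Icc]; omega)
        obtain ⟨x, hx⟩ := hFG _ h4 _ h2
        simp only [mem_inter, mem_union, mem_Icc] at hx
        omega
      · rw [hun]
        exact Finset.Icc_subset_Icc (by omega) le_rfl
      · rw [Nat.card_Icc]; omega
      · rw [show 1 - (a - m + (i - 1)) = 0 by omega, Finset.card_eq_zero] at hCU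
        rw [hCU]
        ext x
        simp only [mem_inter, mem_Icc, hU, Finset.notMem_empty, iff_false]
        omega
  · intro C hC
    obtain ⟨⟨hC1, hC2⟩, hCG, hCm⟩ := (hmem C).1 hC
    rw [← hC2]
    exact Finset.card_lt_card ⟨inter_subset_left, fun h => hCm (h.trans inter_subset_right)⟩
  · intro C hC hlt x hx y hy
    obtain ⟨⟨hC1, hC2⟩, hCG, hCm⟩ := (hmem C).1 hC
    obtain ⟨hxU, hxC⟩ := Finset.mem_sdiff.1 hx
    obtain ⟨hyC, hyV⟩ := Finset.mem_inter.1 hy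
    have hxU' := Finset.mem_Icc.1 hxU
    have hyV' := Finset.mem_Icc.1 hyV
    have hcard : #(insert x (C.erase y)) = β := by
      rw [Finset.card_insert_of_notMem (by simp [hxC]), Finset.card_erase_of_mem hyC, hC2]
      have := Finset.card_pos.2 ⟨y, hyC⟩
      omega
    refine (hmem _).2 ⟨⟨?_, hcard⟩, ?_, ?_⟩
    · intro z hz
      rw [Finset.mem_insert] at hz
      rcases hz with rfl | hz
      · exact Finset.mem_Icc.2 ⟨by omega, by omega⟩
      · exact hC1 (Finset.mem_of_mem_erase hz)
    · have h1 := hGi.exchange hCG (x := x) (y := y) (by simp [hyC])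
        (by simp only [mem_union, mem_Icc, hxC, or_false]; omega) (by omega) (by omega) (by omega)
      convert h1 using 1
      ext z
      simp only [mem_union, mem_insert, mem_erase, mem_Icc]
      have : z = y → ¬ (1 ≤ z ∧ z ≤ i - 1) := by omega
      tauto
    -- If the new set lay in `U`, then `C` would already have `β - 1` elements there, against `hlt`.
    · intro h
      have h1 : insert x (C.erase y) ⊆ insert x (C ∩ U) := by
        intro z hz
        have := @h z hz
        grind
      have h2 := Finset.card_le_card h1
      rw [hcard, Finset.card_insert_of_notMem (by simp [hxC])] at h2
      omega
  · intro h0 C hC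
    obtain ⟨⟨hC1, hC2⟩, hCG, hCm⟩ := (hmem C).1 hC
    have hi1 : i = 1 := by omega
    subst hi1
    -- For `δ = 0` the set `[a] = [m]` is in `F`, and `C` avoids 1, so it meets `[2, m] = U`.
    obtain ⟨x, hx⟩ := hFG _ (hF (Icc 1 a) (Finset.Icc_subset_Icc le_rfl (by omega)) (by simp))
      _ hCG
    simp only [mem_inter, mem_union, mem_Icc] at hx
    obtain ⟨hx1, hx | hx⟩ := hx
    · omega
    · have := Finset.mem_Icc.1 (hC1 hx)
      exact ⟨x, Finset.mem_inter.2 ⟨hx, Finset.mem_Icc.2 ⟨by omega, by omega⟩⟩⟩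

end

/-! ### Consequences of the covering numbers; isomorphism. -/

section

variable {n a b s t : ℕ} {F G : Finset (Finset ℕ)}

theorem coveringNumber_empty (n : ℕ) : coveringNumber n ∅ = 0 :=
  Nat.sInf_eq_zero.2 (Or.inl ⟨∅, ⟨Finset.empty_subset _, by simp⟩, rfl⟩)

theorem coveringNumber_le_right (hG : G ⊆ kSubsets (Icc 1 n) b) (hFG : CrossIntersecting F G)
    (hGt : 0 < coveringNumber n G) : coveringNumber n F ≤ b := by
  obtain ⟨B, hB⟩ : G.Nonempty := by
    rw [Finset.nonempty_iff_ne_empty]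
    rintro rfl
    rw [coveringNumber_empty] at hGt
    exact absurd hGt (lt_irrefl _)
  obtain ⟨h1, h2⟩ := Finset.mem_powersetCard.1 (hG hB)
  refine Nat.sInf_le ⟨B, ⟨h1, fun A hA => ?_⟩, h2⟩
  rw [Finset.inter_comm]
  exact hFG A hA B hB

theorem pos_of_coveringNumber_pos (hG : G ⊆ kSubsets (Icc 1 n) b)
    (hGt : 0 < coveringNumber n G) : 0 < b := by
  obtain ⟨B, hB, -⟩ := exists_disjoint_of_lt_coveringNumber n.zero_le hGt
  -- A positive value is not the default 0 of `sInf ∅`, so a cover exists and no member of `G` is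
  -- empty.
  obtain ⟨-, T, hT, -⟩ := Nat.nonempty_of_pos_sInf hGt
  rw [← (Finset.mem_powersetCard.1 (hG hB)).2]
  exact Finset.card_pos.2 ((hT.2 B hB).mono inter_subset_right)

theorem kSubsets_subset_of_le_coveringNumber (hG : G ⊆ kSubsets (Icc 1 n) b)
    (hGi : IsInitial n G) (ht : 1 ≤ t) (htn : t ≤ n + 1) (hGt : t ≤ coveringNumber n G) :
    kSubsets (Icc 1 (b + t - 1)) b ⊆ G := by
  obtain ⟨B, hB, hd⟩ := exists_disjoint_of_lt_coveringNumber
    (show t - 1 ≤ n by omega) (show t - 1 < coveringNumber n G by omega)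
  intro B' hB'
  obtain ⟨h1, h2⟩ := Finset.mem_powersetCard.1 hB'
  rw [show b + t - 1 = t - 1 + b by omega] at h1
  exact hGi.mem_of_disjoint_Icc hG hB hd h1 h2

/-- A set with fewer than `t` elements in `[b + t - 1]` leaves `b` points of it free, and these form
a member of `G`. -/
theorem subset_extremalLeft (hF : F ⊆ kSubsets (Icc 1 n) a) (hFi : IsInitial n F)
    (hFG : CrossIntersecting F G) (ha : 1 ≤ a)
    (hGm : kSubsets (Icc 1 (b + t - 1)) b ⊆ G) :
    F ⊆ extremalLeft n a (b + t - 1) (coveringNumber n F) t := by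
  obtain ⟨T, hT, hTc⟩ := exists_isCover_card_eq_coveringNumber hF ha
  have hcov := hFi.isCover_Icc hF hT
  intro A hA
  refine Finset.mem_filter.2 ⟨hF hA, ?_, ?_⟩
  · rw [Finset.inter_comm, ← hTc]
    exact hcov.2 A hA
  · by_contra hlt
    obtain ⟨B, hB, hBc⟩ := Finset.exists_subset_card_eq (s := Icc 1 (b + t - 1) \ A) (n := b) (by
      rw [Finset.card_sdiff, Nat.card_Icc]
      omega)
    obtain ⟨x, hx⟩ := hFG A hA B
      (hGm (Finset.mem_powersetCard.2 ⟨hB.trans sdiff_subset, hBc⟩))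
    rw [Finset.mem_inter] at hx
    exact (Finset.mem_sdiff.1 (hB hx.2)).2 hx.1

theorem Isomorphic.card_eq {F G : Finset (Finset ℕ)} (hF : ∀ A ∈ F, A ⊆ Icc 1 n)
    (h : Isomorphic n F G) : #F = #G := by
  obtain ⟨σ, hσ, rfl⟩ := h
  refine (Finset.card_image_of_injOn fun A hA B hB he => ?_).symm
  have key : ∀ A ∈ F, ∀ B ∈ F, A.image σ = B.image σ → A ⊆ B := by
    intro A hA B hB he x hx
    have h1 : σ x ∈ B.image σ := he ▸ Finset.mem_image_of_mem σ hx
    obtain ⟨y, hy, hxy⟩ := Finset.mem_image.1 h1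
    rwa [← hσ.injOn (Finset.mem_coe.2 (hF B hB hy)) (Finset.mem_coe.2 (hF A hA hx)) hxy]
  exact (key A hA B hB he).antisymm (key B hB A hA he.symm)

theorem isomorphic_refl (n : ℕ) (F : Finset (Finset ℕ)) : Isomorphic n F F :=
  ⟨id, Set.bijOn_id _, by simp⟩

end

end CrossFam

/-! ### The theorem. -/

open Finset CrossFam

theorem mainTheorem5 (n a b s t : ℕ) (F G : Finset (Finset ℕ))
    (hF : F ⊆ CrossFam.kSubsets (Finset.Icc 1 n) a)
    (hG : G ⊆ CrossFam.kSubsets (Finset.Icc 1 n) b)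
    (hFi : CrossFam.IsInitial n F) (hGi : CrossFam.IsInitial n G)
    (hFG : CrossFam.CrossIntersecting F G)
    (hab : b + t - 1 ≤ a)
    (hs : CrossFam.coveringNumber n F = s)
    (ht : 2 ≤ t) (hGt : t ≤ CrossFam.coveringNumber n G)
    (hn : a + b ≤ n) :
    F.card + G.card ≤ (CrossFam.extremal n a b s t).card ∧
    ((CrossFam.extremal n a b s t).card : ℤ) =
      ∑ j ∈ Finset.Icc 1 s,
        (((n - j).choose (a - 1) : ℤ) -
          ∑ i ∈ Finset.Icc 0 (t - 2),
            ((b + t - j - 1).choose i : ℤ) * ((n - (b + t - 1)).choose (a - i - 1) : ℤ)) +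
        ((n - s).choose (b - s) : ℤ) + ((b + t - 1).choose b : ℤ) -
        ((b + t - s - 1).choose (b - s) : ℤ) ∧
    (a + b < n →
      (CrossFam.Isomorphic n (F ∪ G) (CrossFam.extremal n a b s t) →
        F.card + G.card = (CrossFam.extremal n a b s t).card) ∧
      (¬ (s = 1 ∧ a = b + t - 1 ∧ 2 ≤ b ∧ (b = 2 ∨ t = 2)) →
        F.card + G.card = (CrossFam.extremal n a b s t).card →
        CrossFam.Isomorphic n (F ∪ G) (CrossFam.extremal n a b s t))) := by
  have hsb : s ≤ b := hs ▸ coveringNumber_le_right hG hFG (by omega)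
  have hb := pos_of_coveringNumber_pos hG (by omega)
  have hcard := card_extremal (n := n) (a := a) (b := b) (s := s) (t := t) (by omega) (by omega)
  have hFL : F ⊆ extremalLeft n a (b + t - 1) s t := by
    rw [← hs]
    exact subset_extremalLeft hF hFi hFG (by omega)
      (kSubsets_subset_of_le_coveringNumber hG hGi (by omega) (by omega) hGt)
  have hFI : 1 ≤ s → ∀ A ⊆ Icc 1 (s - 1 + a), #A = a → A ∈ F := by
    intro h1 A hA hAc
    obtain ⟨A', hA', hd⟩ := exists_disjoint_of_lt_coveringNumber
      (show s - 1 ≤ n by omega) (show s - 1 < coveringNumber n F by omega)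
    exact hFi.mem_of_disjoint_Icc hF hA' hd hA hAc
  have hclass := fun i (hi : i ∈ Icc 1 s) =>
    firstMissing_card_le hGi hFG (hFI (by have := Finset.mem_Icc.1 hi; omega)) hsb ht hab hn hi
  have h1 := card_sdiff_extremalRight_le (s := s) (m := b + t - 1) hG (by omega) (by omega)
  have h2 := Finset.sum_le_sum fun i hi => (hclass i hi).1
  have h3 := sum_card_complNbrs_le hFG hsb ht hab (show b + t - 1 ≤ n by omega)
  have h4 := Finset.card_sdiff_add_card_eq_card hFL
  have h5 := Finset.card_sdiff_add_card_inter G (extremalRight n b (b + t - 1) s)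
  have h6 : #(G ∩ extremalRight n b (b + t - 1) s) ≤ #(extremalRight n b (b + t - 1) s) :=
    Finset.card_le_card inter_subset_right
  refine ⟨by omega, ?_, fun hlt => ⟨fun hiso => ?_, fun hex heq => ?_⟩⟩
  · rw [hcard, Nat.cast_add, card_extremalLeft ht (by omega) (by omega) (by omega),
      card_extremalRight hsb (by omega) (by omega), show b + t - s - 1 = b + t - 1 - s by omega]
    simp only [show ∀ j, b + t - j - 1 = b + t - 1 - j from fun j => by omega]
    ring
  · rw [← hiso.card_eq, Finset.card_union_of_disjoint
      (disjoint_of_subset_kSubsets hF hG (by omega))]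
    intro A hA
    rcases Finset.mem_union.1 hA with hA | hA
    · exact (Finset.mem_powersetCard.1 (hF hA)).1
    · exact (Finset.mem_powersetCard.1 (hG hA)).1
  -- Equality of the totals makes every class inequality tight, so all classes are empty. This gives
  -- literal equality with the extremal family, and the identity serves as the permutation.
  · have h7 := (Finset.sum_eq_sum_iff_of_le fun i hi => (hclass i hi).1).1 (by omega)
    have h8 : ∑ i ∈ Icc 1 s, #(firstMissing n b (b + t - 1) G i) = 0 :=
      Finset.sum_eq_zero fun i hi => by
        rw [(hclass i hi).2 hlt hex (h7 i hi), Finset.card_empty]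
    have hGR : G ⊆ extremalRight n b (b + t - 1) s := by
      rw [← Finset.sdiff_eq_empty_iff_subset, ← Finset.card_eq_zero]
      omega
    have h9 := Finset.card_le_card hGR
    rw [extremal_eq_union, Finset.eq_of_subset_of_card_le hFL (by omega),
      Finset.eq_of_subset_of_card_le hGR (by omega)]
    exact isomorphic_refl _ _
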